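/- Let $R$ be a nonzero commutative ring with identity, let $n\ge 1$ and $\Omega=R[x_1,\dots,x_n]$. For $f\in\Omega$ and $\beta\in\mathbb N^n$, let $f_{[\beta]}$ be the coefficient of $x_1^{\beta_1}\cdots x_n^{\beta_n}$ in $f$, and let $\operatorname{supp}(f)=\{\beta\in\mathbb N^n: f_{[\beta]}\ne0\}$. Order $\mathbb N^n$ componentwise; for $A\subseteq\mathbb N^n$ let $\Delta(A)=\{\beta\in\mathbb N^n:\beta\le\alpha\text{ for some }\alpha\in A\}$, and for $A,B\subseteq\mathbb N^n$ let $A+B=\{\alpha+\beta:\alpha\in A,\ \beta\in B\}$. A polynomial $g\in\Omega$ is monic if $\operatorname{supp}(g)$ has a greatest element $\theta$ and $g_{[\theta]}=1$. A finite family $(g(\lambda))_{\lambda\in\Lambda}$ of monic polynomials lying in an ideal $Q$ of $\Omega$, with $\theta(\lambda)$ the greatest element of $\operatorname{supp}(g(\lambda))$, is a Gröbner basis of $Q$ if for every nonzero $\tau\in Q$ there are $\alpha\in\operatorname{supp}(\tau)$ and $\lambda\in\Lambda$ with $\theta(\lambda)\le\alpha$. A set $X\subseteq R$ satisfies Condition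 (D) if for all $a\ne b$ in $X$ the element $b-a$ is not a zero divisor, i.e. $(b-a)w=0$ implies $w=0$ for all $w\in R$. For each $i\in\{1,\dots,n\}$ let $S_i\subseteq R$ be a finite set, let $\psi_i(u)$ be a positive integer for every $u\in S_i$, and let $E_i\subseteq S_i$. Put $$g_i=\prod_{u\in S_i}(x_i-u)^{\psi_i(u)},\qquad h_i=\prod_{u\in E_i}(x_i-u)^{\psi_i(u)},\qquad \frac{g_i}{h_i}=\prod_{u\in S_i\setminus E_i}(x_i-u)^{\psi_i(u)}.$$ Fix an integer $t\ge1$, let $\Lambda=\{\alpha\in\mathbb N^n:\sum_{i=1}^n\alpha_i\in\{t-1,t\}\}$, and for $\alpha\in\Lambda$ let $$\varphi(\alpha)=\prod_{i=1}^n g_i^{\alpha_i}\ \text{ if }\sum_{i=1}^n\alpha_i=t,\qquad \varphi(\alpha)=\Big(\prod_{i=1}^n g_i^{\alpha_i}\Big)\prod_{i=1}^n\frac{g_i}{h_i}\ \text{ if }\sum_{i=1}^n\alpha_i=t-1.$$ Let $Q$ be the set of all $f\in\Omega$ such that (i) $f(x_1+a_1,\dots,x_n+a_n)_{[\beta]}=0$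 for all $a\in\prod_{i=1}^n S_i\setminus\prod_{i=1}^n E_i$ and all $\beta\in\mathbb N^n$ with $\sum_{i=1}^n\lfloor\beta_i/\psi_i(a_i)\rfloor\le t-1$; (ii) $f(x_1+a_1,\dots,x_n+a_n)_{[\beta]}=0$ for all $a\in\prod_{i=1}^n E_i$ and all $\beta\in\mathbb N^n$ with $\sum_{i=1}^n\lfloor\beta_i/\psi_i(a_i)\rfloor\le t-2$. Then the following hold. (1) $Q$ is an ideal of $\Omega$, and $(\varphi(\alpha))_{\alpha\in\Lambda}$ is a family of monic polynomials, all of which lie in $Q$. (2) If every $S_k$ $(1\le k\le n)$ satisfies Condition (D), then $(\varphi(\alpha))_{\alpha\in\Lambda}$ is a Gröbner basis of $Q$. Moreover, for every $f\in Q$ there is a family $(p(\alpha))_{\alpha\in\Lambda}$ in $\Omega$ such that $f=\sum_{\alpha\in\Lambda}p(\alpha)\varphi(\alpha)$ and $\operatorname{supp}(p(\alpha))+\operatorname{supp}(\varphi(\alpha))\subseteq\Delta(\operatorname{supp}(f))$ for all $\alpha\in\Lambda$. (3) If $\prod_{i=1}^n S_i\ne\emptyset$, $t\ge2$, and $(\varphi(\alpha))_{\alpha\in\Lambda}$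 is a Gröbner basis of $Q$, then every $S_k$ $(1\le k\le n)$ satisfies Condition (D). -/

import Mathlib

open MvPolynomial
open scoped Pointwise

namespace PuncturedNullstellensatz

/-- `X` satisfies Condition (D): the difference of two distinct elements of `X` is never a zero
divisor (where `u` is a zero divisor if `u * w = 0` for some `w ≠ 0`). -/
def ConditionD {R : Type*} [CommRing R] (X : Set R) : Prop :=
  ∀ a ∈ X, ∀ b ∈ X, a ≠ b → b - a ∈ nonZeroDivisors R

/-- A polynomial is monic if its support has a greatest element for the componentwise order on
`ℕⁿ`, and the coefficient there is `1`. -/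
def IsMonic {R : Type*} [CommRing R] {n : ℕ} (g : MvPolynomial (Fin n) R) : Prop :=
  ∃ θ : Fin n →₀ ℕ, IsGreatest (g.support : Set (Fin n →₀ ℕ)) θ ∧ g.coeff θ = 1

/-- A finite family `g` of monic polynomials in the ideal `Q` is a Gröbner basis of `Q` if the
support of every nonzero element of `Q` has an element lying above the greatest element of the
support of some `g r`. -/
def IsGroebnerBasis {R : Type*} [CommRing R] {n : ℕ} {L : Type*} [Finite L]
    (g : L → MvPolynomial (Fin n) R) (Q : Ideal (MvPolynomial (Fin n) R)) : Prop :=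
  (∀ r, IsMonic (g r)) ∧ (∀ r, g r ∈ Q) ∧
    ∀ τ ∈ Q, τ ≠ 0 → ∃ α ∈ τ.support, ∃ r, ∃ θ : Fin n →₀ ℕ,
      IsGreatest ((g r).support : Set (Fin n →₀ ℕ)) θ ∧ θ ≤ α

/-- The polynomial `f(x₁ + a₁, …, xₙ + aₙ)`. -/
noncomputable def shift {R : Type*} [CommRing R] {n : ℕ} (a : Fin n → R)
    (f : MvPolynomial (Fin n) R) : MvPolynomial (Fin n) R :=
  aeval (fun i => X i + C (a i)) f

/-- `f` vanishes at `a` to multiset-order (at least) `s`, for the multiplicities `ψ`: the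
coefficient of `x ^ β` in `f(x + a)` is zero whenever `∑ i, ⌊β i / ψ i (a i)⌋ ≤ s - 1`, where the
bound is read in the integers, so that there is no condition for `s = 0`. -/
def VanishesToOrder {R : Type*} [CommRing R] {n : ℕ} (ψ : Fin n → R → ℕ) (s : ℕ)
    (a : Fin n → R) (f : MvPolynomial (Fin n) R) : Prop :=
  ∀ β : Fin n →₀ ℕ, ∑ i, β i / ψ i (a i) < s → (shift a f).coeff β = 0

/-- The set of polynomials which vanish to multiset-order `t` at the points of `∏ S i` outside
`∏ E i`, and to multiset-order `t - 1` at the points of `∏ E i`. It is used for `1 ≤ t` only. -/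
def vanishingSet {R : Type*} [CommRing R] {n : ℕ} (S E : Fin n → Finset R) (ψ : Fin n → R → ℕ)
    (t : ℕ) : Set (MvPolynomial (Fin n) R) :=
  {f | (∀ a : Fin n → R, (∀ i, a i ∈ S i) → ¬ (∀ i, a i ∈ E i) → VanishesToOrder ψ t a f) ∧
    ∀ a : Fin n → R, (∀ i, a i ∈ E i) → VanishesToOrder ψ (t - 1) a f}

/-- The polynomial `∏ u ∈ T i, (x i - u) ^ ψ i u` in the variable `x i`. For `T = S` it is `g i`,
for `T = E` it is `h i`. -/
noncomputable def rootPoly {R : Type*} [CommRing R] {n : ℕ} (T : Fin n → Finset R)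
    (ψ : Fin n → R → ℕ) (i : Fin n) : MvPolynomial (Fin n) R :=
  ∏ u ∈ T i, (X i - C u) ^ ψ i u

open Classical in
/-- The quotient `g i / h i`, that is `∏ u ∈ S i \ E i, (x i - u) ^ ψ i u`. As `h i` is monic,
it is the only polynomial whose product with `h i` is `g i`. -/
noncomputable def quotPoly {R : Type*} [CommRing R] {n : ℕ} (S E : Fin n → Finset R)
    (ψ : Fin n → R → ℕ) (i : Fin n) : MvPolynomial (Fin n) R :=
  rootPoly (fun k => S k \ E k) ψ i

theorem quotPoly_mul_rootPoly {R : Type*} [CommRing R] {n : ℕ} (S E : Fin n → Finset R)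
    (ψ : Fin n → R → ℕ) (i : Fin n) (h : E i ⊆ S i) :
    quotPoly S E ψ i * rootPoly E ψ i = rootPoly S ψ i := by
  classical
  unfold quotPoly rootPoly
  convert Finset.prod_sdiff (f := fun u => (X i - C u : MvPolynomial (Fin n) R) ^ ψ i u) h

/-- The exponents `α` in `ℕⁿ` with `∑ i, α i ∈ {t - 1, t}`. -/
def indexSet (n t : ℕ) : Finset (Fin n →₀ ℕ) :=
  Finset.univ.finsuppAntidiag (t - 1) ∪ Finset.univ.finsuppAntidiag t

theorem mem_indexSet {n t : ℕ} (α : Fin n →₀ ℕ) :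
    α ∈ indexSet n t ↔ ∑ i, α i = t - 1 ∨ ∑ i, α i = t := by
  simp [indexSet]

/-- The family indexed by `indexSet n t`: `∏ g i ^ α i` if `∑ i, α i = t`, and
`∏ g i ^ α i * ∏ (g i / h i)` if `∑ i, α i = t - 1`. -/
noncomputable def family {R : Type*} [CommRing R] {n : ℕ} (S E : Fin n → Finset R)
    (ψ : Fin n → R → ℕ) (t : ℕ) (α : indexSet n t) : MvPolynomial (Fin n) R :=
  if ∑ i, α.1 i = t then ∏ i, rootPoly S ψ i ^ α.1 i
  else (∏ i, rootPoly S ψ i ^ α.1 i) * ∏ i, quotPoly S E ψ i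

end PuncturedNullstellensatz

/-! For each k, list the elements of `S k` periodically, each u occurring `ψ k u` times per period d
k, those outside `E k` first. The products N_m of the first m i linear factors in each variable
(`newton`) are monic with greatest exponent m, so f is an R-combination of the N_m with m in Δ(supp
f) (`mem_span_newton`). Let a be the point whose coordinates are the nodes at position m, and let β
i count the earlier occurrences of a i. The coefficient of x^β in N_m'(x + a) is zero unless m' ≤ m;
for m' = m it is a product of differences of distinct nodes, hence not a zero divisor under (D).
Periodicity gives ⌊β i / ψ i (a i)⌋ = ⌊m i / d i⌋, so membership in Q kills the coefficients of f on
a lower set of positions (`isLowerSet_positions`, `newton_coeff_eq_zero`). At every other position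
N_m is a multiple of a member of the family, made of initial segments of its factors.

Conversely, let w ≠ 0 kill b - c, with b ≠ c in `S k` and `ψ k c ≤ ψ k b`. Then w (x_k - b)^r = w
(x_k - c)^r, so w g_k still vanishes to order 1 on the grid after the factor at c is dropped.
Putting this in place of one g_k in a suitable member of the family gives a nonzero element of Q,
none of whose exponents lies above a greatest exponent of the family. -/

namespace PuncturedNullstellensatz

/-! ### Greatest exponents of products of monic polynomials -/

section Lead

variable {R : Type*} [CommRing R] {n : ℕ}

/-- Every exponent in the support of `f` is at most `θ`, and the coefficient at `θ` is `1`. -/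
def HasLead (f : MvPolynomial (Fin n) R) (θ : Fin n →₀ ℕ) : Prop :=
  (∀ β ∈ f.support, β ≤ θ) ∧ f.coeff θ = 1

theorem HasLead.isGreatest [Nontrivial R] {f : MvPolynomial (Fin n) R} {θ : Fin n →₀ ℕ}
    (h : HasLead f θ) : IsGreatest (f.support : Set (Fin n →₀ ℕ)) θ :=
  ⟨by simp [h.2], fun β hβ => h.1 β hβ⟩

theorem HasLead.isMonic [Nontrivial R] {f : MvPolynomial (Fin n) R} {θ : Fin n →₀ ℕ}
    (h : HasLead f θ) : IsMonic f := ⟨θ, h.isGreatest, h.2⟩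

theorem HasLead.unique [Nontrivial R] {f : MvPolynomial (Fin n) R} {θ η : Fin n →₀ ℕ}
    (h : HasLead f θ) (h' : HasLead f η) : θ = η :=
  h.isGreatest.unique h'.isGreatest

theorem HasLead.one : HasLead (1 : MvPolynomial (Fin n) R) 0 := by
  refine ⟨fun β hβ => ?_, by simp⟩
  have : β = 0 := by
    by_contra h
    rw [mem_support_iff, coeff_one, if_neg (Ne.symm h)] at hβ
    exact hβ rfl
  exact this.le

/-- No cancellation occurs at the top: x ≤ θ, y ≤ η and x + y = θ + η force x = θ and y = η, so a
single term contributes, over any R. -/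
theorem HasLead.mul {f g : MvPolynomial (Fin n) R} {θ η : Fin n →₀ ℕ}
    (hf : HasLead f θ) (hg : HasLead g η) : HasLead (f * g) (θ + η) := by
  classical
  constructor
  · intro β hβ
    obtain ⟨b, hb, c, hc, rfl⟩ := Finset.mem_add.1 (support_mul f g hβ)
    exact add_le_add (hf.1 b hb) (hg.1 c hc)
  · rw [coeff_mul, Finset.sum_eq_single (θ, η), hf.2, hg.2, one_mul]
    · rintro ⟨x, y⟩ hxy hne
      rw [Finset.HasAntidiagonal.mem_antidiagonal] at hxy
      by_contra h
      have hx : x ≤ θ := hf.1 x (mem_support_iff.2 (left_ne_zero_of_mul h))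
      have hy : y ≤ η := hg.1 y (mem_support_iff.2 (right_ne_zero_of_mul h))
      have hxy' : x = θ ∧ y = η := by
        constructor <;> ext i <;>
        · have h1 := DFunLike.congr_fun hxy i
          have h2 := hx i
          have h3 := hy i
          simp only [Finsupp.add_apply] at h1
          omega
      exact hne (Prod.ext hxy'.1 hxy'.2)
    · intro h
      exact (h (by simp)).elim

theorem HasLead.prod {ι : Type*} (s : Finset ι) {f : ι → MvPolynomial (Fin n) R}
    {θ : ι → Fin n →₀ ℕ} (h : ∀ i ∈ s, HasLead (f i) (θ i)) :
    HasLead (∏ i ∈ s, f i) (∑ i ∈ s, θ i) := by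
  classical
  induction s using Finset.induction_on with
  | empty => simpa using HasLead.one
  | insert a s ha ih =>
    rw [Finset.prod_insert ha, Finset.sum_insert ha]
    exact (h a (Finset.mem_insert_self a s)).mul
      (ih fun i hi => h i (Finset.mem_insert_of_mem hi))

theorem HasLead.pow {f : MvPolynomial (Fin n) R} {θ : Fin n →₀ ℕ} (h : HasLead f θ) (k : ℕ) :
    HasLead (f ^ k) (k • θ) := by
  simpa using HasLead.prod (Finset.range k) (f := fun _ => f) (θ := fun _ => θ) fun _ _ => h

theorem HasLead.X_sub_C (i : Fin n) (u : R) :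
    HasLead (X i - C u : MvPolynomial (Fin n) R) (Finsupp.single i 1) := by
  classical
  constructor
  · intro β hβ
    by_contra hle
    rw [mem_support_iff, coeff_sub, coeff_X, coeff_C] at hβ
    rw [if_neg (by rintro rfl; exact hle le_rfl), if_neg (by rintro rfl; exact hle (zero_le))]
      at hβ
    simp at hβ
  · rw [coeff_sub, coeff_X, coeff_C, if_pos rfl, if_neg, sub_zero]
    intro h
    have := DFunLike.congr_fun h i
    simp at this

theorem hasLead_rootPoly (T : Fin n → Finset R) (ψ : Fin n → R → ℕ) (i : Fin n) :
    HasLead (rootPoly T ψ i) (Finsupp.single i (∑ u ∈ T i, ψ i u)) := by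
  have := HasLead.prod (T i) fun u _ => (HasLead.X_sub_C i u).pow (ψ i u)
  rw [Finsupp.single_finsetSum]
  simpa [rootPoly] using this

open Classical in
theorem hasLead_family (S E : Fin n → Finset R) (ψ : Fin n → R → ℕ) (t : ℕ) (α : indexSet n t) :
    HasLead (family S E ψ t α) (∑ i, Finsupp.single i
      (α.1 i * ∑ u ∈ S i, ψ i u + if ∑ i, α.1 i = t then 0 else ∑ u ∈ S i \ E i, ψ i u)) := by
  have h := HasLead.prod Finset.univ fun i _ => (hasLead_rootPoly S ψ i).pow (α.1 i)
  have h' := HasLead.prod Finset.univ fun i _ => hasLead_rootPoly (fun k => S k \ E k) ψ i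
  unfold family
  split_ifs
  · simpa using h
  · simpa [quotPoly, Finset.sum_add_distrib] using h.mul h'

theorem sum_single_apply (D : Fin n → ℕ) (k : Fin n) :
    (∑ i, Finsupp.single i (D i) : Fin n →₀ ℕ) k = D k := by
  simp [Finsupp.single_apply]

end Lead

/-! ### Multiset-order of vanishing -/

section Vanishing

variable {R : Type*} [CommRing R] {n : ℕ} {ψ : Fin n → R → ℕ} {a : Fin n → R}

theorem shift_X_sub_C (a : Fin n → R) (i : Fin n) (u : R) :
    shift a (X i - C u) = X i + C (a i - u) := by
  simp [shift, algebraMap_eq, add_sub_assoc]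

theorem shift_mul (a : Fin n → R) (f g : MvPolynomial (Fin n) R) :
    shift a (f * g) = shift a f * shift a g := map_mul _ _ _

theorem shift_prod {ι : Type*} (a : Fin n → R) (s : Finset ι) (f : ι → MvPolynomial (Fin n) R) :
    shift a (∏ i ∈ s, f i) = ∏ i ∈ s, shift a (f i) := map_prod (aeval _) _ _

theorem vanishesToOrder_zero (f : MvPolynomial (Fin n) R) : VanishesToOrder ψ 0 a f :=
  fun _ h => (Nat.not_lt_zero _ h).elim

theorem VanishesToOrder.mono {s s' : ℕ} {f : MvPolynomial (Fin n) R}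
    (h : VanishesToOrder ψ s a f) (hs : s' ≤ s) : VanishesToOrder ψ s' a f :=
  fun β hβ => h β (hβ.trans_le hs)

/-- Floors of quotients are superadditive, so in each splitting β = x + y either x is below order s
or y is below order s'. -/
theorem VanishesToOrder.mul {s s' : ℕ} {f g : MvPolynomial (Fin n) R}
    (hf : VanishesToOrder ψ s a f) (hg : VanishesToOrder ψ s' a g) :
    VanishesToOrder ψ (s + s') a (f * g) := by
  classical
  intro β hβ
  rw [shift_mul, coeff_mul]
  refine Finset.sum_eq_zero ?_
  rintro ⟨x, y⟩ hxy
  rw [Finset.HasAntidiagonal.mem_antidiagonal] at hxy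
  subst hxy
  have hle : ∑ i, x i / ψ i (a i) + ∑ i, y i / ψ i (a i) ≤ ∑ i, (x + y) i / ψ i (a i) := by
    rw [← Finset.sum_add_distrib]
    exact Finset.sum_le_sum fun i _ => Nat.div_add_div_le_add_div
  rcases lt_or_ge (∑ i, x i / ψ i (a i)) s with h | h
  · simp [hf x h]
  · simp [hg y (by simp only at hβ; omega)]

theorem VanishesToOrder.mul_left {s : ℕ} {f : MvPolynomial (Fin n) R}
    (hf : VanishesToOrder ψ s a f) (g : MvPolynomial (Fin n) R) :
    VanishesToOrder ψ s a (g * f) := by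
  simpa using (vanishesToOrder_zero g).mul hf

theorem VanishesToOrder.of_dvd {s : ℕ} {f g : MvPolynomial (Fin n) R}
    (hf : VanishesToOrder ψ s a f) (h : f ∣ g) : VanishesToOrder ψ s a g := by
  obtain ⟨c, rfl⟩ := h
  rw [mul_comm]
  exact hf.mul_left c

theorem VanishesToOrder.pow {s : ℕ} {f : MvPolynomial (Fin n) R}
    (hf : VanishesToOrder ψ s a f) (k : ℕ) : VanishesToOrder ψ (k * s) a (f ^ k) := by
  induction k with
  | zero => simpa using vanishesToOrder_zero (ψ := ψ) (a := a) 1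
  | succ k ih =>
    rw [pow_succ, add_mul, one_mul]
    exact ih.mul hf

theorem VanishesToOrder.prod {ι : Type*} (s : Finset ι) {k : ι → ℕ}
    {f : ι → MvPolynomial (Fin n) R} (hf : ∀ i ∈ s, VanishesToOrder ψ (k i) a (f i)) :
    VanishesToOrder ψ (∑ i ∈ s, k i) a (∏ i ∈ s, f i) := by
  classical
  induction s using Finset.induction_on with
  | empty => simpa using vanishesToOrder_zero (ψ := ψ) (a := a) 1
  | insert b s hb ih =>
    rw [Finset.prod_insert hb, Finset.sum_insert hb]
    exact (hf b (Finset.mem_insert_self b s)).mul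
      (ih fun i hi => hf i (Finset.mem_insert_of_mem hi))

theorem vanishesToOrder_X_sub_C_pow (i : Fin n) (hi : 0 < ψ i (a i)) :
    VanishesToOrder ψ 1 a ((X i - C (a i)) ^ ψ i (a i)) := by
  classical
  intro β hβ
  have h : shift a ((X i - C (a i)) ^ ψ i (a i)) = X i ^ ψ i (a i) := by
    have := map_pow (aeval (R := R) fun i => X i + C (a i)) (X i - C (a i)) (ψ i (a i))
    rw [shift, this]
    simp [algebraMap_eq]
  rw [h, coeff_X_pow, if_neg]
  rintro rfl
  have := Finset.single_le_sum (f := fun k => (Finsupp.single i (ψ i (a i))) k / ψ k (a k))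
    (fun _ _ => Nat.zero_le _) (Finset.mem_univ i)
  simp only [Finsupp.single_eq_same, Nat.div_self hi] at this
  omega

theorem vanishesToOrder_rootPoly {T : Fin n → Finset R} {i : Fin n} (hi : a i ∈ T i)
    (hψ : 0 < ψ i (a i)) : VanishesToOrder ψ 1 a (rootPoly T ψ i) :=
  (vanishesToOrder_X_sub_C_pow i hψ).of_dvd
    (Finset.dvd_prod_of_mem (fun u => (X i - C u : MvPolynomial (Fin n) R) ^ ψ i u) hi)

/-- The ideal of polynomials which vanish to order `s` at `a`. -/
noncomputable def vanishingIdealAt (ψ : Fin n → R → ℕ) (s : ℕ) (a : Fin n → R) :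
    Ideal (MvPolynomial (Fin n) R) where
  carrier := {f | VanishesToOrder ψ s a f}
  zero_mem' := fun β _ => by simp [shift]
  add_mem' := fun {_ _} hf hg β hβ => by
    rw [shift, map_add, coeff_add]
    exact (congrArg₂ _ (hf β hβ) (hg β hβ)).trans (add_zero 0)
  smul_mem' := fun c _ hf => VanishesToOrder.mul_left hf c

/-- The ideal whose set of elements is `vanishingSet S E ψ t`. -/
noncomputable def vanishingIdeal (S E : Fin n → Finset R) (ψ : Fin n → R → ℕ) (t : ℕ) :
    Ideal (MvPolynomial (Fin n) R) where
  carrier := vanishingSet S E ψ t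
  zero_mem' := ⟨fun a _ _ => (vanishingIdealAt ψ t a).zero_mem,
    fun a _ => (vanishingIdealAt ψ (t - 1) a).zero_mem⟩
  add_mem' := fun {_ _} hf hg =>
    ⟨fun a h h' => (vanishingIdealAt ψ t a).add_mem (hf.1 a h h') (hg.1 a h h'),
      fun a h => (vanishingIdealAt ψ (t - 1) a).add_mem (hf.2 a h) (hg.2 a h)⟩
  smul_mem' := fun c _ hf => ⟨fun a h h' => VanishesToOrder.mul_left (hf.1 a h h') c,
    fun a h => VanishesToOrder.mul_left (hf.2 a h) c⟩

/-- A point of the grid outside ∏ `E i` has some coordinate in `S i \ E i`, and the factor for that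
i already vanishes there. -/
theorem vanishesToOrder_prod_quotPoly {S E : Fin n → Finset R}
    (hψ : ∀ k, ∀ u ∈ S k, 0 < ψ k u) (ha : ∀ i, a i ∈ S i) (ha' : ¬ ∀ i, a i ∈ E i) :
    VanishesToOrder ψ 1 a (∏ i, quotPoly S E ψ i) := by
  classical
  push Not at ha'
  obtain ⟨i, hi⟩ := ha'
  refine VanishesToOrder.of_dvd ?_ (Finset.dvd_prod_of_mem _ (Finset.mem_univ i))
  exact vanishesToOrder_rootPoly (by simp [ha i, hi]) (hψ i _ (ha i))

theorem family_mem {S E : Fin n → Finset R} (hE : ∀ k, E k ⊆ S k)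
    (hψ : ∀ k, ∀ u ∈ S k, 0 < ψ k u) {t : ℕ} (ht : 1 ≤ t) (α : indexSet n t) :
    family S E ψ t α ∈ vanishingSet S E ψ t := by
  have hα := (mem_indexSet α.1).1 α.2
  have key : ∀ a : Fin n → R, (∀ i, a i ∈ S i) →
      VanishesToOrder ψ (∑ i, α.1 i) a (∏ i, rootPoly S ψ i ^ α.1 i) := fun a ha => by
    simpa using VanishesToOrder.prod Finset.univ fun i _ =>
      (vanishesToOrder_rootPoly (ha i) (hψ i _ (ha i))).pow (α.1 i)
  unfold family
  split_ifs with h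
  · exact ⟨fun a ha _ => (key a ha).mono h.ge,
      fun a ha => (key a fun i => hE i (ha i)).mono (by omega)⟩
  · refine ⟨fun a ha ha' => ?_, fun a ha => ?_⟩
    · exact ((key a ha).mul (vanishesToOrder_prod_quotPoly hψ ha ha')).mono (by omega)
    · rw [mul_comm]
      exact ((key a fun i => hE i (ha i)).mul_left _).mono (by omega)

end Vanishing

/-! ### Periodic sequences of nodes -/

/-- A list of the elements of `T`, each repeated `ψ` times. -/
theorem exists_list_count {R : Type*} [DecidableEq R] (T : Finset R) (ψ : R → ℕ) :
    ∃ l : List R, ∀ a, l.count a = if a ∈ T then ψ a else 0 := by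
  refine ⟨(∑ u ∈ T, Multiset.replicate (ψ u) u).toList, fun a => ?_⟩
  rw [← Multiset.coe_count, Multiset.coe_toList, Multiset.count_sum']
  simp [Multiset.count_replicate]

theorem count_add_of_periodic {R : Type*} [DecidableEq R] {d : ℕ} {u : ℕ → R}
    (hu : ∀ m, u (m + d) = u m) (a : R) (q s : ℕ) :
    Nat.count (fun j => u j = a) (q * d + s) =
      q * Nat.count (fun j => u j = a) d + Nat.count (fun j => u j = a) s := by
  induction q with
  | zero => simp
  | succ q ih =>
    have : (q + 1) * d + s = d + (q * d + s) := by ring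
    rw [this, Nat.count_add]
    simp only [Nat.add_comm d, hu]
    rw [ih]
    ring

theorem prod_range_comp_eq_prod_pow_count {R A : Type*} [DecidableEq R] [CommMonoid A]
    {S : Finset R} {u : ℕ → R} (hu : ∀ m, u m ∈ S) (f : R → A) (s : ℕ) :
    ∏ j ∈ Finset.range s, f (u j) = ∏ v ∈ S, f v ^ Nat.count (fun j => u j = v) s := by
  rw [← Finset.prod_fiberwise_of_maps_to (fun j (_ : j ∈ Finset.range s) => hu j)]
  refine Finset.prod_congr rfl fun v _ => ?_
  rw [Nat.count_eq_card_filter_range]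
  exact Finset.prod_eq_pow_card fun j hj => by rw [(Finset.mem_filter.1 hj).2]

/-- A periodic enumeration of the elements of `S` with multiplicities `ψ`, in which the elements
outside `E` come first in each period. -/
theorem exists_rootSequence {R : Type*} [DecidableEq R] (A : Type*) [CommMonoid A] (S E : Finset R)
    (hS : S.Nonempty) (hE : E ⊆ S) (ψ : R → ℕ) (hψ : ∀ u ∈ S, 0 < ψ u) :
    ∃ (u : ℕ → R) (d e : ℕ), 0 < d ∧ (∀ m, u m ∈ S) ∧ (∀ m, u m ∈ E ↔ e ≤ m % d) ∧
      (∀ m, Nat.count (fun j => u j = u m) m / ψ (u m) = m / d) ∧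
      (∀ (f : R → A) (q : ℕ),
        ∏ j ∈ Finset.range (q * d), f (u j) = (∏ v ∈ S, f v ^ ψ v) ^ q) ∧
      (∀ (f : R → A) (q : ℕ), ∏ j ∈ Finset.range (q * d + e), f (u j) =
        (∏ v ∈ S, f v ^ ψ v) ^ q * ∏ v ∈ S \ E, f v ^ ψ v) := by
  obtain ⟨l₁, hc₁⟩ := exists_list_count (S \ E) ψ
  obtain ⟨l₂, hc₂⟩ := exists_list_count E ψ
  have mem₁ : ∀ a, a ∈ l₁ → a ∈ S \ E := fun a ha => by
    by_contra h
    have := List.count_pos_iff.2 ha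
    simp only [hc₁, if_neg h, lt_irrefl] at this
  have mem₂ : ∀ a, a ∈ l₂ → a ∈ E := fun a ha => by
    by_contra h
    have := List.count_pos_iff.2 ha
    simp only [hc₂, if_neg h, lt_irrefl] at this
  set l := l₁ ++ l₂ with hl
  have hcl : ∀ a ∈ S, l.count a = ψ a := fun a ha => by
    rw [hl, List.count_append, hc₁, hc₂]
    by_cases h : a ∈ E <;> simp [h, ha]
  obtain ⟨a₀, ha₀⟩ := hS
  have hd : 0 < l.length := by
    have := List.count_le_length (a := a₀) (l := l)
    have := hcl a₀ ha₀
    have := hψ a₀ ha₀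
    omega
  let u : ℕ → R := fun j => l.getD (j % l.length) a₀
  have hper : ∀ m, u (m + l.length) = u m := fun m => by simp [u]
  have hmod : ∀ m, u (m % l.length) = u m := fun m => by simp [u]
  have hget : ∀ m (h : m < l.length), u m = l[m] := fun m hm => by
    simp [u, Nat.mod_eq_of_lt hm, hm]
  have humod : ∀ m, u m = l[m % l.length]'(Nat.mod_lt _ hd) := fun m => by
    rw [← hmod, hget]
  have hcount : ∀ a s, s ≤ l.length →
      Nat.count (fun j => u j = a) s = (l.take s).count a := by
    intro a s hs
    induction s with
    | zero => simp
    | succ s ih =>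
      rw [Nat.count_succ, ih (by omega), hget s (by omega), List.take_add_one,
        List.getElem?_eq_getElem (by omega), List.count_append]
      simp [List.count_singleton]
  have hE' : ∀ m, u m ∈ E ↔ l₁.length ≤ m % l.length := fun m => by
    rw [humod]
    simp only [hl]
    rw [List.getElem_append]
    split_ifs with h
    · have := (Finset.mem_sdiff.1 (mem₁ _ (List.getElem_mem h))).2
      exact ⟨fun h' => (this h').elim, fun h' => absurd h (not_lt.2 h')⟩
    · exact ⟨fun _ => not_lt.1 h, fun _ => mem₂ _ (List.getElem_mem _)⟩
  have hS' : ∀ m, u m ∈ S := fun m => by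
    rw [humod]
    rcases List.mem_append.1 (List.getElem_mem (Nat.mod_lt m hd)) with h | h
    · exact (Finset.mem_sdiff.1 (mem₁ _ h)).1
    · exact hE (mem₂ _ h)
  have hcd : ∀ a ∈ S, Nat.count (fun j => u j = a) l.length = ψ a := fun a ha => by
    rw [hcount a _ le_rfl, List.take_length, hcl a ha]
  refine ⟨u, l.length, l₁.length, hd, hS', hE', fun m => ?_, fun f q => ?_, fun f q => ?_⟩
  · have h1 : Nat.count (fun j => u j = u m) m = (m / l.length) * ψ (u m) +
        Nat.count (fun j => u j = u m) (m % l.length) := by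
      have := count_add_of_periodic hper (u m) (m / l.length) (m % l.length)
      rwa [Nat.div_add_mod', hcd _ (hS' m)] at this
    -- Position m % d itself carries the node u m, so strictly fewer than ψ (u m) of its occurrences
    -- in one period come earlier.
    have h2 : Nat.count (fun j => u j = u m) (m % l.length) < ψ (u m) := by
      rw [← hcd _ (hS' m), Nat.lt_iff_add_one_le, ← Nat.count_succ_eq_succ_count]
      · exact Nat.count_monotone _ (Nat.mod_lt m hd)
      · exact hmod m
    rw [h1, add_comm, Nat.add_mul_div_right _ _ (hψ _ (hS' m)), Nat.div_eq_of_lt h2, zero_add]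
  · rw [prod_range_comp_eq_prod_pow_count hS', ← Finset.prod_pow]
    refine Finset.prod_congr rfl fun v hv => ?_
    have := count_add_of_periodic hper v q 0
    rw [add_zero, Nat.count_zero, add_zero, hcd v hv] at this
    rw [this, mul_comm, pow_mul]
  -- The last e factors exhaust `S \ E`; writing their product over `S` allows a comparison node by
  -- node.
  · have hsd : ∏ v ∈ S \ E, f v ^ ψ v = ∏ v ∈ S, f v ^ (if v ∈ S \ E then ψ v else 0) := by
      rw [← Finset.prod_subset (Finset.sdiff_subset (s := S) (t := E))]
      · exact Finset.prod_congr rfl fun v hv => by rw [if_pos hv]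
      · exact fun v _ hv => by rw [if_neg hv, pow_zero]
    rw [prod_range_comp_eq_prod_pow_count hS', ← Finset.prod_pow, hsd, ← Finset.prod_mul_distrib]
    refine Finset.prod_congr rfl fun v hv => ?_
    rw [count_add_of_periodic hper, hcd v hv, hcount v _ (by simp [hl]), hl, List.take_left,
      hc₁, pow_add, mul_comm q, pow_mul]

/-! ### Newton basis and triangularity of its Taylor coefficients -/

section Newton

variable {R : Type*} [CommRing R] {n : ℕ}

/-- The Newton basis polynomial of exponent `m` for the sequences of nodes `u i`. -/
noncomputable def newton (u : Fin n → ℕ → R) (m : Fin n →₀ ℕ) : MvPolynomial (Fin n) R :=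
  ∏ i, ∏ j ∈ Finset.range (m i), (X i - C (u i j))

theorem hasLead_newton (u : Fin n → ℕ → R) (m : Fin n →₀ ℕ) : HasLead (newton u m) m := by
  have h := HasLead.prod Finset.univ fun i _ =>
    HasLead.prod (Finset.range (m i)) fun j _ => HasLead.X_sub_C i (u i j)
  have hm : ∑ i, ∑ _j ∈ Finset.range (m i), Finsupp.single i 1 = m := by
    ext k
    simp
  rwa [hm] at h

theorem mem_of_monomial_mem {M : Submodule R (MvPolynomial (Fin n) R)}
    {f : MvPolynomial (Fin n) R} (h : ∀ γ ∈ f.support, monomial γ (1 : R) ∈ M) : f ∈ M := by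
  rw [f.as_sum]
  refine M.sum_mem fun γ hγ => ?_
  have : monomial γ (coeff γ f) = coeff γ f • monomial γ (1 : R) := by
    rw [smul_monomial, smul_eq_mul, mul_one]
  rw [this]
  exact M.smul_mem _ (h γ hγ)

/-- Well-founded induction on exponents: subtracting the monomial x^β from the Newton polynomial
leaves only exponents γ < β, which stay in the lower set D. -/
theorem mem_span_newton (u : Fin n → ℕ → R) {D : Set (Fin n →₀ ℕ)} (hD : IsLowerSet D)
    {f : MvPolynomial (Fin n) R} (hf : ∀ β ∈ f.support, β ∈ D) :
    f ∈ Submodule.span R (newton u '' D) := by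
  classical
  refine mem_of_monomial_mem fun β hβ => ?_
  replace hβ := hf β hβ
  induction β using WellFoundedLT.induction with
  | ind β ih =>
    have h1 : newton u β - monomial β (1 : R) ∈ Submodule.span R (newton u '' D) := by
      refine mem_of_monomial_mem fun γ hγ => ?_
      have hlt : γ < β := by
        have hne : γ ≠ β := by
          rintro rfl
          simp [(hasLead_newton u γ).2] at hγ
        refine lt_of_le_of_ne ((hasLead_newton u β).1 γ ?_) hne
        rw [mem_support_iff, coeff_sub, coeff_monomial, if_neg hne.symm, sub_zero] at hγ
        exact mem_support_iff.2 hγ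
      exact ih γ hlt (hD hlt.le hβ)
    have h2 := Submodule.sub_mem _
      (Submodule.subset_span (R := R) (Set.mem_image_of_mem (newton u) hβ)) h1
    simpa using h2

variable [DecidableEq R]

/-- The multiplicity exponent belonging to the position `m` in the sequences of nodes. -/
noncomputable def nodeExponent (u : Fin n → ℕ → R) (m : Fin n →₀ ℕ) : Fin n →₀ ℕ :=
  Finsupp.equivFunOnFinite.symm fun i => Nat.count (fun j => u i j = u i (m i)) (m i)

theorem prod_range_X_add_C (v : ℕ → R) (b : R) (i : Fin n) (k : ℕ) :
    ∏ j ∈ Finset.range k, (X i + C (b - v j) : MvPolynomial (Fin n) R) =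
      X i ^ Nat.count (fun j => v j = b) k *
        ∏ j ∈ (Finset.range k).filter (fun j => ¬ v j = b), (X i + C (b - v j)) := by
  rw [← Finset.prod_filter_mul_prod_filter_not (Finset.range k) (fun j => v j = b),
    Nat.count_eq_card_filter_range]
  congr 1
  refine Finset.prod_eq_pow_card fun j hj => ?_
  rw [(Finset.mem_filter.1 hj).2, sub_self, C_0, add_zero]

theorem shift_newton (a : Fin n → R) (u : Fin n → ℕ → R) (m : Fin n →₀ ℕ) :
    shift a (newton u m) =
      ∏ i, (X i ^ Nat.count (fun j => u i j = a i) (m i) *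
        ∏ j ∈ (Finset.range (m i)).filter (fun j => ¬ u i j = a i), (X i + C (a i - u i j))) := by
  simp only [newton, shift_prod, shift_X_sub_C, prod_range_X_add_C]

/-- If m i < m' i, the node at position m i occurs among the first m' i nodes once more than before
position m i, so the shifted polynomial is divisible by too high a power of x_i. -/
theorem coeff_shift_newton_of_not_le {u : Fin n → ℕ → R} {m m' : Fin n →₀ ℕ} (h : ¬ m' ≤ m) :
    coeff (nodeExponent u m) (shift (fun i => u i (m i)) (newton u m')) = 0 := by
  obtain ⟨i, hi⟩ := not_forall.1 h
  have hlt : nodeExponent u m i + 1 ≤ Nat.count (fun j => u i j = u i (m i)) (m' i) := by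
    refine le_trans ?_ (Nat.count_monotone (fun j => u i j = u i (m i)) (not_le.1 hi))
    exact (Nat.count_succ_eq_succ_count (p := fun j => u i j = u i (m i)) rfl).ge
  have hdvd : X i ^ (nodeExponent u m i + 1) ∣ shift (fun i => u i (m i)) (newton u m') := by
    rw [shift_newton]
    exact ((pow_dvd_pow _ hlt).trans (dvd_mul_right _ _)).trans
      (Finset.dvd_prod_of_mem _ (Finset.mem_univ i))
  obtain ⟨c, hc⟩ := hdvd
  rw [hc, X_pow_eq_monomial, coeff_monomial_mul', if_neg]
  intro hle
  have := hle i
  simp at this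

/-- The nodes equal to the coordinates of the point contribute exactly the monomial; what remains is
the constant term of the other factors. -/
theorem coeff_shift_newton_self (u : Fin n → ℕ → R) (m : Fin n →₀ ℕ) :
    coeff (nodeExponent u m) (shift (fun i => u i (m i)) (newton u m)) =
      ∏ i, ∏ j ∈ (Finset.range (m i)).filter (fun j => ¬ u i j = u i (m i)),
        (u i (m i) - u i j) := by
  have hX : ∏ i, (X i : MvPolynomial (Fin n) R) ^ Nat.count (fun j => u i j = u i (m i)) (m i) =
      monomial (nodeExponent u m) 1 := by
    rw [monomial_eq, C_1, one_mul, Finsupp.prod_fintype _ _ (by simp)]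
    rfl
  rw [shift_newton, Finset.prod_mul_distrib, hX]
  have h := coeff_monomial_mul 0 (nodeExponent u m) (1 : R)
    (∏ i, ∏ j ∈ (Finset.range (m i)).filter (fun j => ¬ u i j = u i (m i)),
        (X i + C (u i (m i) - u i j)) : MvPolynomial (Fin n) R)
  rw [add_zero, one_mul] at h
  rw [h, ← constantCoeff_eq]
  simp

/-- The linear system for c is triangular, with diagonal entries that are not zero divisors. Since B
is a lower set, the smaller unknowns are already known to vanish. -/
theorem newton_coeff_eq_zero {u : Fin n → ℕ → R}
    (hu : ∀ i j k, u i j ≠ u i k → u i k - u i j ∈ nonZeroDivisors R)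
    {B : Set (Fin n →₀ ℕ)} (hB : IsLowerSet B) (c : (Fin n →₀ ℕ) →₀ R)
    (h : ∀ m ∈ B, coeff (nodeExponent u m)
      (shift (fun i => u i (m i)) (Finsupp.linearCombination R (newton u) c)) = 0)
    {m : Fin n →₀ ℕ} (hm : m ∈ B) : c m = 0 := by
  induction m using WellFoundedLT.induction with
  | ind m ih =>
    have h1 := h m hm
    have h2 : coeff (nodeExponent u m)
        (shift (fun i => u i (m i)) (Finsupp.linearCombination R (newton u) c)) =
        c.sum fun m' r => r *
          coeff (nodeExponent u m) (shift (fun i => u i (m i)) (newton u m')) := by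
      rw [Finsupp.linearCombination_apply, shift, Finsupp.sum, map_sum, coeff_sum]
      refine Finset.sum_congr rfl fun m' _ => ?_
      rw [map_smul, coeff_smul]
      rfl
    rw [h2, Finsupp.sum, Finset.sum_eq_single m, coeff_shift_newton_self] at h1
    · refine (mem_nonZeroDivisors_iff.1 ?_).2 _ h1
      exact prod_mem fun i _ => prod_mem fun j hj => hu i j (m i) (Finset.mem_filter.1 hj).2
    · intro m' _ hne
      by_cases hle : m' ≤ m
      · rw [ih m' (lt_of_le_of_ne hle hne) (hB hle hm), zero_mul]
      · rw [coeff_shift_newton_of_not_le hle, mul_zero]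
    · intro h
      rw [Finsupp.notMem_support_iff.1 h, zero_mul]

end Newton

/-! ### Decomposition along the family under Condition (D) -/

section Decomposition

variable {R : Type*} [CommRing R] {n : ℕ}

/-- The polynomials `∑ α, p α * φ α` for which the supports of the products `p α * φ α`
formally lie in `D`. -/
noncomputable def decomposable {L : Type*} [Fintype L] (φ : L → MvPolynomial (Fin n) R)
    (D : Set (Fin n →₀ ℕ)) : Submodule R (MvPolynomial (Fin n) R) where
  carrier := {f | ∃ p : L → MvPolynomial (Fin n) R, f = ∑ α, p α * φ α ∧
    ∀ α, ((p α).support : Set (Fin n →₀ ℕ)) + ((φ α).support : Set (Fin n →₀ ℕ)) ⊆ D}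
  zero_mem' := ⟨0, by simp, by simp⟩
  add_mem' := by
    classical
    rintro _ _ ⟨p, rfl, hp⟩ ⟨q, rfl, hq⟩
    refine ⟨p + q, by simp [add_mul, Finset.sum_add_distrib], fun α => ?_⟩
    rintro _ ⟨b, hb, c, hc, rfl⟩
    rcases Finset.mem_union.1 (support_add hb) with h | h
    · exact hp α (Set.add_mem_add h hc)
    · exact hq α (Set.add_mem_add h hc)
  smul_mem' := by
    rintro r _ ⟨p, rfl, hp⟩
    refine ⟨fun α => r • p α, by simp only [Finset.smul_sum, smul_mul_assoc], fun α => ?_⟩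
    rintro _ ⟨b, hb, c, hc, rfl⟩
    exact hp α (Set.add_mem_add (support_smul hb) hc)

theorem mul_mem_decomposable {L : Type*} [Fintype L] {φ : L → MvPolynomial (Fin n) R}
    {D : Set (Fin n →₀ ℕ)} (α : L) (p : MvPolynomial (Fin n) R)
    (h : (p.support : Set (Fin n →₀ ℕ)) + ((φ α).support : Set (Fin n →₀ ℕ)) ⊆ D) :
    p * φ α ∈ decomposable φ D := by
  classical
  refine ⟨Pi.single α p, ?_, fun α' => ?_⟩
  · rw [Finset.sum_eq_single α]
    · simp
    · intro b _ hb
      simp [hb]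
    · simp
  · by_cases h' : α' = α
    · subst h'
      simpa using h
    · simp [h']

theorem exists_le_sum_eq (q : Fin n → ℕ) {t : ℕ} (h : t ≤ ∑ i, q i) :
    ∃ α : Fin n →₀ ℕ, (∀ i, α i ≤ q i) ∧ ∑ i, α i = t := by
  classical
  induction t with
  | zero => exact ⟨0, by simp, by simp⟩
  | succ t ih =>
    obtain ⟨α, hα, hs⟩ := ih (by omega)
    obtain ⟨i, -, hi⟩ : ∃ i ∈ Finset.univ, α i < q i := Finset.exists_lt_of_sum_lt (by omega)
    refine ⟨α + Finsupp.single i 1, fun k => ?_, ?_⟩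
    · by_cases hk : i = k
      · subst hk
        simpa using hi
      · simpa [Finsupp.single_apply, hk] using hα k
    · simp [Finset.sum_add_distrib, hs, Finsupp.single_apply]

/-- A Newton basis polynomial is a multiple of a product of initial segments of its factors. -/
theorem newton_mem_decomposable [Nontrivial R] {L : Type*} [Fintype L]
    {φ : L → MvPolynomial (Fin n) R} {D : Set (Fin n →₀ ℕ)} (hD : IsLowerSet D)
    {u : Fin n → ℕ → R} {m : Fin n →₀ ℕ} (hm : m ∈ D) (α : L) {k : Fin n → ℕ}
    (hk : ∀ i, k i ≤ m i)
    (hα : φ α = ∏ i, ∏ j ∈ Finset.range (k i), (X i - C (u i j))) :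
    newton u m ∈ decomposable φ D := by
  set p : MvPolynomial (Fin n) R := ∏ i, ∏ j ∈ Finset.Ico (k i) (m i), (X i - C (u i j)) with hp
  have hpφ : newton u m = p * φ α := by
    rw [hp, hα, mul_comm, ← Finset.prod_mul_distrib, newton]
    exact Finset.prod_congr rfl fun i _ => (Finset.prod_range_mul_prod_Ico _ (hk i)).symm
  have h1 := HasLead.prod Finset.univ fun i _ =>
    HasLead.prod (Finset.Ico (k i) (m i)) fun j _ => HasLead.X_sub_C i (u i j)
  have h2 := HasLead.prod Finset.univ fun i _ =>
    HasLead.prod (Finset.range (k i)) fun j _ => HasLead.X_sub_C i (u i j)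
  rw [← hα] at h2
  rw [← hp] at h1
  -- The greatest exponents of p and φ α add up to m, so every formal sum of their exponents is at
  -- most m and stays in D.
  have hm' := (h1.mul h2).unique (hpφ ▸ hasLead_newton u m)
  rw [hpφ]
  refine mul_mem_decomposable α p ?_
  rintro _ ⟨b, hb, c, hc, rfl⟩
  refine hD ?_ hm
  rw [← hm']
  exact add_le_add (h1.1 b hb) (h2.1 c hc)

theorem IsGroebnerBasis.of_decomposable [Nontrivial R] {L : Type*} [Fintype L]
    {φ : L → MvPolynomial (Fin n) R} {Q : Ideal (MvPolynomial (Fin n) R)}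
    (hφ : ∀ α, IsMonic (φ α)) (hQ : ∀ α, φ α ∈ Q)
    (h : ∀ f ∈ Q, f ∈ decomposable φ
      (lowerClosure (f.support : Set (Fin n →₀ ℕ)) : Set (Fin n →₀ ℕ))) :
    IsGroebnerBasis φ Q := by
  refine ⟨hφ, hQ, fun τ hτ h0 => ?_⟩
  obtain ⟨p, hp, hsupp⟩ := h τ hτ
  obtain ⟨α, hα⟩ : ∃ α, p α ≠ 0 := by
    by_contra! hp0
    exact h0 (by rw [hp]; simp [hp0])
  obtain ⟨b, hb⟩ := support_nonempty.2 hα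
  obtain ⟨θ, hθ, -⟩ := hφ α
  obtain ⟨β, hβ, hle⟩ := hsupp α (Set.add_mem_add hb hθ.1)
  exact ⟨β, hβ, α, θ, hθ, le_add_self.trans hle⟩

/-- The positions whose Taylor coefficients vanish for every element of the vanishing set form a
lower set. -/
theorem isLowerSet_positions (d e : Fin n → ℕ) (t : ℕ) :
    IsLowerSet {m : Fin n →₀ ℕ | ∑ i, m i / d i < t ∧
      ((∀ i, e i ≤ m i % d i) → ∑ i, m i / d i < t - 1)} := by
  rintro m m' hle ⟨h1, h2⟩
  have hi : ∀ i ∈ Finset.univ, m' i / d i ≤ m i / d i := fun i _ => Nat.div_le_div_right (hle i)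
  have hsum := Finset.sum_le_sum hi
  refine ⟨hsum.trans_lt h1, fun he => ?_⟩
  rcases hsum.lt_or_eq with h | h
  · omega
  -- Equal sums force equal quotients in every coordinate. Then m' ≤ m passes to the remainders, and
  -- e ≤ m' % d gives e ≤ m % d.
  · refine hsum.trans_lt (h2 fun i => ?_)
    have hq := (Finset.sum_eq_sum_iff_of_le hi).1 h i (Finset.mem_univ i)
    have := he i
    have := hle i
    have h3 := Nat.div_add_mod (m i) (d i)
    have h4 := Nat.div_add_mod (m' i) (d i)
    rw [hq] at h4
    omega

theorem mem_decomposable_of_mem_vanishingSet [Nontrivial R] {S E : Fin n → Finset R}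
    (hE : ∀ k, E k ⊆ S k) {ψ : Fin n → R → ℕ} (hψ : ∀ k, ∀ u ∈ S k, 0 < ψ k u)
    {t : ℕ} (ht : 1 ≤ t) (hD : ∀ k, ConditionD (S k : Set R))
    {f : MvPolynomial (Fin n) R} (hf : f ∈ vanishingSet S E ψ t) :
    f ∈ decomposable (family S E ψ t)
      (lowerClosure (f.support : Set (Fin n →₀ ℕ)) : Set (Fin n →₀ ℕ)) := by
  classical
  have hlow := (lowerClosure (f.support : Set (Fin n →₀ ℕ))).lower
  by_cases hS : ∀ k, (S k).Nonempty
  · choose u d e hd huS huE hdiv hprod hprod' using fun k =>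
      exists_rootSequence (MvPolynomial (Fin n) R) (S k) (E k) (hS k) (hE k) (ψ k) (hψ k)
    have hspan := mem_span_newton u hlow (f := f) fun β hβ => subset_lowerClosure hβ
    obtain ⟨c, hc, hcf⟩ := (Finsupp.mem_span_image_iff_linearCombination R).1 hspan
    have hzero : ∀ m, ∑ i, m i / d i < t ∧
        ((∀ i, e i ≤ m i % d i) → ∑ i, m i / d i < t - 1) → c m = 0 := fun m hm => by
      refine newton_coeff_eq_zero (u := u) (fun i j k hne => hD i _ (huS i j) _ (huS i k) hne)
        (isLowerSet_positions d e t) c (fun m hm => ?_) hm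
      have hexp : ∑ i, nodeExponent u m i / ψ i (u i (m i)) = ∑ i, m i / d i :=
        Finset.sum_congr rfl fun i _ => hdiv i (m i)
      rw [hcf]
      by_cases hmE : ∀ i, u i (m i) ∈ E i
      · exact hf.2 _ hmE _ (by rw [hexp]; exact hm.2 fun i => (huE i _).1 (hmE i))
      · exact hf.1 _ (fun i => huS i _) hmE _ (by rw [hexp]; exact hm.1)
    have hmem : Finsupp.linearCombination R (newton u) c ∈ decomposable (family S E ψ t)
        (lowerClosure (f.support : Set (Fin n →₀ ℕ)) : Set (Fin n →₀ ℕ)) := by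
      refine Submodule.sum_mem _ fun m hm => Submodule.smul_mem _ _ ?_
      have hmD := hc hm
      by_cases hmt : t ≤ ∑ i, m i / d i
      · obtain ⟨α, hα, hs⟩ := exists_le_sum_eq _ hmt
        refine newton_mem_decomposable hlow hmD (u := u)
          ⟨α, (mem_indexSet α).2 (Or.inr hs)⟩ (k := fun i => α i * d i) (fun i => ?_) ?_
        · exact (Nat.mul_le_mul_right _ (hα i)).trans (Nat.div_mul_le_self _ _)
        · rw [family, if_pos hs]
          exact Finset.prod_congr rfl fun i _ => (hprod i (fun v => X i - C v) (α i)).symm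
      -- A surviving position with quotient sum below t has quotient sum exactly t - 1 and all
      -- remainders at least e. It thus contains all full periods plus the initial block for `S i \
      -- E i`, which yields the factor g_i / h_i.
      · have hm' : (∀ i, e i ≤ m i % d i) ∧ t - 1 ≤ ∑ i, m i / d i := by
          by_contra hcon
          refine Finsupp.mem_support_iff.1 hm (hzero m ⟨not_le.1 hmt, fun he => ?_⟩)
          by_contra hlt
          exact hcon ⟨he, not_lt.1 hlt⟩
        have hs : ∑ i, m i / d i = t - 1 := by omega
        refine newton_mem_decomposable hlow hmD (u := u)
          ⟨Finsupp.equivFunOnFinite.symm fun i => m i / d i, (mem_indexSet _).2 (Or.inl hs)⟩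
          (k := fun i => m i / d i * d i + e i) (fun i => ?_) ?_
        · have := Nat.div_add_mod' (m i) (d i)
          have := hm'.1 i
          omega
        · rw [family, if_neg (by simp only [Finsupp.equivFunOnFinite_symm_apply_apply]; omega),
            ← Finset.prod_mul_distrib]
          refine Finset.prod_congr rfl fun i _ => ((hprod' i (fun v => X i - C v) _).trans ?_).symm
          unfold quotPoly rootPoly
          congr!
    rwa [hcf] at hmem
  -- If some `S k` is empty then g_k = 1, and the family contains g_k^t = 1.
  · obtain ⟨k, hk⟩ := not_forall.1 hS
    rw [Finset.not_nonempty_iff_eq_empty] at hk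
    have hs : ∑ i, Finsupp.single k t i = t := by simp [Finsupp.single_apply]
    have h1 : family S E ψ t ⟨Finsupp.single k t, (mem_indexSet _).2 (Or.inr hs)⟩ = 1 := by
      rw [family, if_pos hs]
      refine Finset.prod_eq_one fun i _ => ?_
      by_cases hi : k = i
      · subst hi
        simp [rootPoly, hk]
      · simp [hi]
    have h2 := mul_mem_decomposable (φ := family S E ψ t)
      (D := lowerClosure (f.support : Set (Fin n →₀ ℕ)))
      ⟨Finsupp.single k t, (mem_indexSet _).2 (Or.inr hs)⟩ f
    rw [h1, mul_one] at h2
    refine h2 ?_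
    rintro _ ⟨b, hb, c, hc, rfl⟩
    have hc0 := HasLead.one.1 c hc
    exact hlow ((add_le_add_right hc0 b).trans (add_zero b).le) (subset_lowerClosure hb)

end Decomposition

/-! ### Necessity of Condition (D) -/

section Converse

variable {R : Type*} [CommRing R] {n : ℕ}

theorem C_mul_X_sub_C_pow {w b c : R} (h : w * (b - c) = 0) (i : Fin n) (r : ℕ) :
    C w * (X i - C b : MvPolynomial (Fin n) R) ^ r = C w * (X i - C c) ^ r := by
  have h1 : C w * (X i - C b : MvPolynomial (Fin n) R) = C w * (X i - C c) := by
    have : (C (w * (b - c)) : MvPolynomial (Fin n) R) = 0 := by rw [h, C_0]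
    rw [C_mul, C_sub] at this
    linear_combination -this
  induction r with
  | zero => simp
  | succ r ih => rw [pow_succ, ← mul_assoc, ih, pow_succ]; linear_combination (X i - C c) ^ r * h1

/-- If `w` annihilates the difference of two nodes, then the node of smaller multiplicity can be
left out of `w * g k`. -/
theorem vanishesToOrder_C_mul_rootPoly_erase [DecidableEq R] {S : Fin n → Finset R}
    {ψ : Fin n → R → ℕ} (hψ : ∀ k, ∀ u ∈ S k, 0 < ψ k u) {k : Fin n} {b c w : R}
    (hb : b ∈ S k) (hbc : b ≠ c) (hle : ψ k c ≤ ψ k b) (hw : w * (b - c) = 0) {a : Fin n → R}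
    (ha : ∀ i, a i ∈ S i) :
    VanishesToOrder ψ 1 a (C w * rootPoly (fun i => (S i).erase c) ψ k) := by
  by_cases hc : a k = c
  · subst hc
    have hdvd : (X k - C b : MvPolynomial (Fin n) R) ^ ψ k b ∣
        rootPoly (fun i => (S i).erase (a k)) ψ k :=
      Finset.dvd_prod_of_mem (fun u => (X k - C u : MvPolynomial (Fin n) R) ^ ψ k u)
        (Finset.mem_erase.2 ⟨hbc, hb⟩)
    refine (vanishesToOrder_X_sub_C_pow k (hψ k _ (ha k))).of_dvd ?_
    -- At c, the factor belonging to b takes over: multiplied by w, it equals a power of x_k - c of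
    -- exponent at least `ψ k c`.
    refine (pow_dvd_pow _ hle).trans (Dvd.dvd.trans ?_ (mul_dvd_mul_left (C w) hdvd))
    rw [C_mul_X_sub_C_pow hw]
    exact dvd_mul_left _ _
  · exact (vanishesToOrder_rootPoly (T := fun i => (S i).erase c)
      (Finset.mem_erase.2 ⟨hc, ha k⟩) (hψ k _ (ha k))).mul_left _

-- The coefficient of w g at η is w ≠ 0, so the Gröbner property applies; all exponents of w g are
-- at most η, so η dominates a greatest exponent of the family.
open Classical in
theorem IsGroebnerBasis.exists_le [Nontrivial R] {S E : Fin n → Finset R} {ψ : Fin n → R → ℕ}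
    {t : ℕ} {Q : Ideal (MvPolynomial (Fin n) R)} (h : IsGroebnerBasis (family S E ψ t) Q)
    {g : MvPolynomial (Fin n) R} {η : Fin n →₀ ℕ} (hg : HasLead g η) {w : R} (hw : w ≠ 0)
    (hQ : C w * g ∈ Q) : ∃ α : Fin n → ℕ, (∑ i, α i = t - 1 ∨ ∑ i, α i = t) ∧
      ∀ i, α i * ∑ u ∈ S i, ψ i u +
        (if ∑ i, α i = t then 0 else ∑ u ∈ S i \ E i, ψ i u) ≤ η i := by
  have h0 : C w * g ≠ 0 := by
    intro h0
    have := coeff_C_mul η w g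
    rw [h0, hg.2, coeff_zero, mul_one] at this
    exact hw this.symm
  obtain ⟨β, hβ, α, θ, hθ, hle⟩ := h.2.2 _ hQ h0
  refine ⟨α.1, (mem_indexSet α.1).1 α.2, fun i => ?_⟩
  have hβη : β ≤ η := by
    refine hg.1 β (mem_support_iff.2 fun hz => ?_)
    rw [mem_support_iff, coeff_C_mul, hz, mul_zero] at hβ
    exact hβ rfl
  have := (hle.trans hβη) i
  rwa [hθ.unique (hasLead_family S E ψ t α).isGreatest, sum_single_apply] at this

theorem IsGroebnerBasis.eq_zero_of_mul_sub_eq_zero [Nontrivial R] {S E : Fin n → Finset R}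
    (hE : ∀ k, E k ⊆ S k) {ψ : Fin n → R → ℕ} (hψ : ∀ k, ∀ u ∈ S k, 0 < ψ k u)
    (hS : ∀ k, (S k).Nonempty) {t : ℕ} (ht : 2 ≤ t) {Q : Ideal (MvPolynomial (Fin n) R)}
    (hQ : (Q : Set (MvPolynomial (Fin n) R)) = vanishingSet S E ψ t)
    (h : IsGroebnerBasis (family S E ψ t) Q) {k : Fin n} {b c w : R}
    (hb : b ∈ S k) (hc : c ∈ S k) (hbc : b ≠ c) (hle : ψ k c ≤ ψ k b) (hw : w * (b - c) = 0) :
    w = 0 := by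
  classical
  by_contra hw0
  obtain ⟨r, rfl⟩ : ∃ r, t = r + 2 := ⟨t - 2, by omega⟩
  have hT := hasLead_rootPoly (fun i => (S i).erase c) ψ k
  have hT' := Finset.sum_erase_add (S k) (ψ k) hc
  have hcpos := hψ k c hc
  set T := rootPoly (fun i => (S i).erase c) ψ k
  set eT := ∑ u ∈ (S k).erase c, ψ k u
  have hsplit : ∀ i, ∑ u ∈ S i \ E i, ψ i u + ∑ u ∈ E i, ψ i u = ∑ u ∈ S i, ψ i u :=
    fun i => Finset.sum_sdiff (hE i)
  have hSpos : ∀ i, 0 < ∑ u ∈ S i, ψ i u := fun i =>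
    Finset.sum_pos (hψ i) (hS i)
  have hvan : ∀ (s : ℕ) (a : Fin n → R), (∀ i, a i ∈ S i) →
      VanishesToOrder ψ (1 + s) a (C w * T * rootPoly S ψ k ^ s) := fun s a ha => by
    have h1 := vanishesToOrder_C_mul_rootPoly_erase hψ hb hbc hle hw ha
    have h2 := (vanishesToOrder_rootPoly (T := S) (ha k) (hψ k _ (ha k))).pow s
    rw [mul_one] at h2
    exact h1.mul h2
  have hlead : ∀ s : ℕ, HasLead (T * rootPoly S ψ k ^ s)
      (Finsupp.single k (eT + s * ∑ u ∈ S k, ψ k u)) := fun s => by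
    have := hT.mul ((hasLead_rootPoly S ψ k).pow s)
    rwa [Finsupp.smul_single, smul_eq_mul, ← Finsupp.single_add] at this
  by_cases hEne : ∀ i, (E i).Nonempty
  -- With t = r + 2, the orders add up to 1 + r + 1 = t off ∏ `E i` and to 1 + r = t - 1 on it. As
  -- each `E i` is nonempty, g_i / h_i has smaller degree than g_i, which forces α to be supported
  -- at k.
  · have hmem : C w * (T * rootPoly S ψ k ^ r * ∏ i, quotPoly S E ψ i) ∈ Q := by
      rw [← SetLike.mem_coe, hQ, ← mul_assoc, ← mul_assoc]
      refine ⟨fun a ha ha' => ?_, fun a ha => ?_⟩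
      · exact ((hvan r a ha).mul (vanishesToOrder_prod_quotPoly hψ ha ha')).mono (by omega)
      · rw [mul_comm]
        exact ((hvan r a fun i => hE i (ha i)).mul_left _).mono (by omega)
    obtain ⟨α, hα, hαle⟩ := h.exists_le ((hlead r).mul (HasLead.prod Finset.univ fun i _ =>
      hasLead_rootPoly (fun k => S k \ E k) ψ i)) hw0 hmem
    simp only [Finsupp.add_apply, sum_single_apply] at hαle
    have hz : ∀ i, i ≠ k → α i = 0 := fun i hi => by
      have h1 := hαle i
      rw [Finsupp.single_eq_of_ne hi, zero_add] at h1
      have h2 := hsplit i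
      have h3 : 0 < ∑ u ∈ E i, ψ i u := Finset.sum_pos (fun u hu => hψ i u (hE i hu)) (hEne i)
      by_contra hne
      have := Nat.le_mul_of_pos_left (∑ u ∈ S i, ψ i u) (Nat.pos_of_ne_zero hne)
      omega
    rw [Finset.sum_eq_single k (fun i _ hi => hz i hi) (by simp)] at hα hαle
    have hk := hαle k
    rw [Finsupp.single_eq_same] at hk
    have h2 := hsplit k
    have h3 : 0 < ∑ u ∈ E k, ψ k u := Finset.sum_pos (fun u hu => hψ k u (hE k hu)) (hEne k)
    rcases hα with hα | hα
    · rw [if_neg (by omega), hα, show r + 2 - 1 = r + 1 by omega, add_mul] at hk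
      omega
    · rw [if_pos hα, hα, add_mul] at hk
      omega
  · obtain ⟨i₀, hi₀⟩ := not_forall.1 hEne
    -- With ∏ `E i` empty only order t on the grid is required, so the factors g_i / h_i are not
    -- needed. Members with exponent sum t - 1 are excluded at i₀, where g_i / h_i is all of g_i.
    have hmem : C w * (T * rootPoly S ψ k ^ (r + 1)) ∈ Q := by
      rw [← SetLike.mem_coe, hQ, ← mul_assoc]
      exact ⟨fun a ha _ => (hvan (r + 1) a ha).mono (by omega),
        fun a ha => (hi₀ ⟨_, ha i₀⟩).elim⟩
    obtain ⟨α, hα, hαle⟩ := h.exists_le (hlead (r + 1)) hw0 hmem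
    have hz : ∀ i, i ≠ k → α i = 0 := fun i hi => by
      have h1 := hαle i
      rw [Finsupp.single_eq_of_ne hi] at h1
      by_contra hne
      have := Nat.le_mul_of_pos_left (∑ u ∈ S i, ψ i u) (Nat.pos_of_ne_zero hne)
      have := hSpos i
      omega
    rw [Finset.sum_eq_single k (fun i _ hi => hz i hi) (by simp)] at hα hαle
    have hk := hαle k
    rw [Finsupp.single_eq_same] at hk
    rcases hα with hα | hα
    · have hi₀' := hαle i₀
      have h2 := hsplit i₀
      have h3 := hSpos i₀
      rw [Finset.not_nonempty_iff_eq_empty.1 hi₀, Finset.sum_empty] at h2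
      rw [if_neg (by omega), Finset.not_nonempty_iff_eq_empty.1 hi₀] at hi₀'
      by_cases hik : i₀ = k
      · subst hik
        rw [Finsupp.single_eq_same, hα, show r + 2 - 1 = r + 1 by omega] at hi₀'
        omega
      · rw [Finsupp.single_eq_of_ne hik] at hi₀'
        omega
    · rw [if_pos hα, hα, show r + 2 = (r + 1) + 1 by omega, add_mul (r + 1)] at hk
      omega

theorem IsGroebnerBasis.conditionD [Nontrivial R] {S E : Fin n → Finset R}
    (hE : ∀ k, E k ⊆ S k) {ψ : Fin n → R → ℕ} (hψ : ∀ k, ∀ u ∈ S k, 0 < ψ k u)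
    (hS : ∀ k, (S k).Nonempty) {t : ℕ} (ht : 2 ≤ t) {Q : Ideal (MvPolynomial (Fin n) R)}
    (hQ : (Q : Set (MvPolynomial (Fin n) R)) = vanishingSet S E ψ t)
    (h : IsGroebnerBasis (family S E ψ t) Q) (k : Fin n) : ConditionD (S k : Set R) := by
  intro a ha b hb hab
  rw [mem_nonZeroDivisors_iff_right]
  intro w hw
  rcases le_total (ψ k a) (ψ k b) with hle | hle
  · exact h.eq_zero_of_mul_sub_eq_zero hE hψ hS ht hQ hb ha hab.symm hle hw
  · exact h.eq_zero_of_mul_sub_eq_zero hE hψ hS ht hQ ha hb hab hle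
      (by linear_combination -hw)

end Converse

end PuncturedNullstellensatz

open PuncturedNullstellensatz in
theorem theorem5p4 {R : Type*} [CommRing R] [Nontrivial R] (n : ℕ) (hn : 0 < n)
    (S E : Fin n → Finset R) (hE : ∀ k, E k ⊆ S k)
    (ψ : Fin n → R → ℕ) (hψ : ∀ k, ∀ u ∈ S k, 0 < ψ k u)
    (t : ℕ) (ht : 1 ≤ t) :
    ∃ Q : Ideal (MvPolynomial (Fin n) R),
      (Q : Set (MvPolynomial (Fin n) R)) = vanishingSet S E ψ t ∧
      (∀ α, IsMonic (family S E ψ t α)) ∧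
      (∀ α, family S E ψ t α ∈ Q) ∧
      ((∀ k, ConditionD (S k : Set R)) →
        IsGroebnerBasis (family S E ψ t) Q ∧
        ∀ f ∈ Q, ∃ p : indexSet n t → MvPolynomial (Fin n) R,
          f = ∑ α, p α * family S E ψ t α ∧
          ∀ α, ((p α).support : Set (Fin n →₀ ℕ)) + ((family S E ψ t α).support : Set _) ⊆
            (lowerClosure (f.support : Set (Fin n →₀ ℕ)) : Set (Fin n →₀ ℕ))) ∧
      ((Set.univ.pi fun k => (S k : Set R)).Nonempty → 2 ≤ t →
        IsGroebnerBasis (family S E ψ t) Q →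
        ∀ k, ConditionD (S k : Set R)) := by
  have hmonic : ∀ α, IsMonic (family S E ψ t α) := fun α => (hasLead_family S E ψ t α).isMonic
  refine ⟨vanishingIdeal S E ψ t, rfl, hmonic, family_mem hE hψ ht, fun hD => ⟨?_, ?_⟩,
    fun ⟨a, ha⟩ ht' h => h.conditionD hE hψ (fun k => ⟨a k, ha k trivial⟩) ht' rfl⟩
  · exact IsGroebnerBasis.of_decomposable hmonic (family_mem hE hψ ht)
      fun f hf => mem_decomposable_of_mem_vanishingSet hE hψ ht hD hf
  · exact fun f hf => mem_decomposable_of_mem_vanishingSet hE hψ ht hD hf
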